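/- Let $n,m\ge 0$ be integers. A point cluster of degree $m$ in $\mathbb P^n(\mathbb C)$ is a formal sum $Z=\sum_{j=1}^m P_j$ of (not necessarily distinct) points $P_j\in\mathbb P^n(\mathbb C)$. For a linear subspace $L\subset\mathbb P^n$ let $\deg Z|_L$ be the number of points of $Z$, counted with multiplicity, that lie in $L$. The cluster $Z$ is called stable if $(n+1)\deg Z|_L<(\dim L+1)\,m$ for every linear subspace $\emptyset\ne L\subsetneq\mathbb P^n$. A point cluster with scaling $\tilde Z$ is a point cluster $Z$ together with a choice of nonzero coordinate row vectors $P_j\in\mathbb C^{n+1}$ for its points, up to scaling these vectors by factors whose product is $1$; it is called stable if the underlying cluster $Z$ is stable. Let $\mathcal H_{n,\mathbb C}$ be the space of positive definite Hermitian $(n+1)\times(n+1)$-matrices modulo scaling by positive real numbers, with its natural structure of a smooth real manifold. For a point cluster with scaling $\tilde Z$ represented by $P_1,\dots,P_m$, let \[ D_{\tilde Z}(Q)=\sum_{j=1}^m\log\bigl(\bar P_jQP_j^\top\bigr)-\frac{m}{n+1}\log\det Q, \] which is a well-defined function on $\mathcal H_{n,\mathbb C}$. If $\tilde Z$ is stable,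 then $D_{\tilde Z}$ has a unique critical point $z(Z)$ on $\mathcal H_{n,\mathbb C}$, and at this point $D_{\tilde Z}$ attains its global minimum, which can be written as $\log\theta(\tilde Z)$ for some real number $\theta(\tilde Z)>0$. The point $z(Z)$ depends only on the cluster $Z$ underlying $\tilde Z$, not on the scaling. -/

import Mathlib

open scoped LinearAlgebra.Projectivization Matrix ComplexOrder

noncomputable section

namespace PointClusters

/-- Coordinate vectors in `ℂ^(n+1)`. -/
abbrev Vec (n : ℕ) : Type := Fin (n + 1) → ℂ

/-- Complex `(n+1) × (n+1)`-matrices. -/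
abbrev Mat (n : ℕ) : Type := Matrix (Fin (n + 1)) (Fin (n + 1)) ℂ

/-! ### Point clusters -/

/-- A point cluster (positive zero-cycle) of degree `m` in `ℙⁿ(ℂ)`: a formal sum of `m` points,
i.e. a multiset of `m` points. -/
abbrev Cluster (n m : ℕ) : Type := Sym (ℙ ℂ (Vec n)) m

open Classical in
/-- The degree of `Z|_L`: the number of points of `Z`, with multiplicity, on the linear subspace
of `ℙⁿ` given by the vector subspace `L` of `ℂ^(n+1)`. -/
def Cluster.degOn {n m : ℕ} (Z : Cluster n m) (L : Submodule ℂ (Vec n)) : ℕ :=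
  (Z : Multiset (ℙ ℂ (Vec n))).countP (fun P => P.submodule ≤ L)

/-- Stability: `(n+1) deg Z|_L < (dim L + 1) deg Z` for all linear subspaces `∅ ≠ L ⊊ ℙⁿ`. For the
projective subspace given by the vector subspace `L`, the number `dim L + 1` is `finrank ℂ L`. -/
def Cluster.IsStable {n m : ℕ} (Z : Cluster n m) : Prop :=
  ∀ L : Submodule ℂ (Vec n), L ≠ ⊥ → L ≠ ⊤ →
    (n + 1) * Z.degOn L < Module.finrank ℂ L * m

/-- An `m`-tuple of nonzero coordinate vectors. -/
abbrev Coords (n m : ℕ) : Type := Fin m → {v : Vec n // v ≠ 0}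

/-- Two tuples of coordinate vectors define the same point cluster with scaling if they agree up to
order and up to scaling the vectors by factors whose product is `1`. -/
def Coords.Rel {n m : ℕ} (P P' : Coords n m) : Prop :=
  ∃ (σ : Equiv.Perm (Fin m)) (c : Fin m → ℂ), ∏ j, c j = 1 ∧
    ∀ j, (P' j : Vec n) = c j • (P (σ j) : Vec n)

theorem Coords.rel_equivalence (n m : ℕ) : Equivalence (@Coords.Rel n m) where
  refl P := ⟨1, 1, by simp, by simp⟩
  symm := by
    rintro P P' ⟨σ, c, hc, h⟩
    have hne : ∀ j, c j ≠ 0 := fun j hj => by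
      have := Finset.prod_eq_zero (Finset.mem_univ j) hj
      rw [hc] at this
      exact one_ne_zero this
    refine ⟨σ⁻¹, fun j => (c (σ⁻¹ j))⁻¹, ?_, fun j => ?_⟩
    · rw [Equiv.prod_comp σ⁻¹ (fun j => (c j)⁻¹), Finset.prod_inv_distrib, hc, inv_one]
    · have := h (σ⁻¹ j)
      rw [show σ (σ⁻¹ j) = j from σ.apply_symm_apply j] at this
      rw [this, smul_smul, inv_mul_cancel₀ (hne _), one_smul]
  trans := by
    rintro P P' P'' ⟨σ, c, hc, h⟩ ⟨τ, d, hd, h'⟩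
    refine ⟨σ * τ, fun j => d j * c (τ j), ?_, fun j => ?_⟩
    · rw [Finset.prod_mul_distrib, hd, Equiv.prod_comp τ c, hc, one_mul]
    · rw [h' j, h (τ j), smul_smul, Equiv.Perm.mul_apply]

instance Coords.setoid (n m : ℕ) : Setoid (Coords n m) := ⟨Coords.Rel, Coords.rel_equivalence n m⟩

/-- Point clusters with scaling of degree `m`. -/
def ScaledCluster (n m : ℕ) : Type := Quotient (Coords.setoid n m)

/-- The cluster `∑ⱼ (Pⱼ)` of the points with coordinate vectors `Pⱼ`. -/
def Coords.toCluster {n m : ℕ} (P : Coords n m) : Cluster n m :=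
  ⟨Finset.univ.val.map (fun j => Projectivization.mk ℂ (P j : Vec n) (P j).2), by simp⟩

theorem Coords.toCluster_eq {n m : ℕ} (P P' : Coords n m) (h : P ≈ P') :
    P.toCluster = P'.toCluster := by
  obtain ⟨σ, c, hc, h⟩ := h
  apply Subtype.ext
  have hfun : (fun j => Projectivization.mk ℂ (P' j : Vec n) (P' j).2)
      = (fun j => Projectivization.mk ℂ (P j : Vec n) (P j).2) ∘ σ := by
    funext j
    exact (Projectivization.mk_eq_mk_iff' ℂ _ _ _ _).2 ⟨c j, (h j).symm⟩
  have hσ : (Finset.univ : Finset (Fin m)).val.map σ = Finset.univ.val := by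
    exact congrArg Finset.val (Finset.map_univ_equiv σ)
  change Multiset.map (fun j => Projectivization.mk ℂ (P j : Vec n) (P j).2) Finset.univ.val
    = Multiset.map (fun j => Projectivization.mk ℂ (P' j : Vec n) (P' j).2) Finset.univ.val
  rw [hfun, ← Multiset.map_map, hσ]

/-- The image `Z` of the point cluster with scaling `Z̃`. -/
def ScaledCluster.toCluster {n m : ℕ} (Z : ScaledCluster n m) : Cluster n m :=
  Quotient.lift Coords.toCluster Coords.toCluster_eq Z

/-- Stable point clusters. -/
abbrev StableCluster (n m : ℕ) : Type := {Z : Cluster n m // Z.IsStable}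

/-- Stable point clusters with scaling. -/
abbrev StableScaledCluster (n m : ℕ) : Type := {Z : ScaledCluster n m // Z.toCluster.IsStable}

/-- The stable point cluster `Z` underlying a stable point cluster with scaling `Z̃`. -/
def StableScaledCluster.toStable {n m : ℕ} (Z : StableScaledCluster n m) : StableCluster n m :=
  ⟨Z.1.toCluster, Z.2⟩

/-! ### Positive definite Hermitian forms modulo scaling -/

/-- Positive definite Hermitian matrices of size `n+1`. -/
abbrev PosDefMat (n : ℕ) : Type := {Q : Mat n // Q.PosDef}

/-- Equality up to a positive real factor. -/
def PosDefMat.Rel {n : ℕ} (Q Q' : PosDefMat n) : Prop :=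
  ∃ c : ℝ, 0 < c ∧ (Q' : Mat n) = c • (Q : Mat n)

theorem PosDefMat.rel_equivalence (n : ℕ) : Equivalence (@PosDefMat.Rel n) where
  refl Q := ⟨1, one_pos, by simp⟩
  symm := by
    rintro Q Q' ⟨c, hc, h⟩
    exact ⟨c⁻¹, inv_pos.2 hc, by rw [h, smul_smul, inv_mul_cancel₀ hc.ne', one_smul]⟩
  trans := by
    rintro Q Q' Q'' ⟨c, hc, h⟩ ⟨d, hd, h'⟩
    exact ⟨d * c, mul_pos hd hc, by rw [h', h, smul_smul]⟩

instance PosDefMat.setoid (n : ℕ) : Setoid (PosDefMat n) :=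
  ⟨PosDefMat.Rel, PosDefMat.rel_equivalence n⟩

/-- The space `ℋ_{n,ℂ}` of positive definite Hermitian forms in `n+1` variables modulo scaling by
positive real factors. -/
def HermSpace (n : ℕ) : Type := Quotient (PosDefMat.setoid n)

/-- The class in `ℋ_{n,ℂ}` of a positive definite Hermitian matrix. -/
def HermSpace.mk {n : ℕ} (Q : PosDefMat n) : HermSpace n := Quotient.mk _ Q

/-- The real vector space of Hermitian matrices of size `n+1`. -/
abbrev HermMat (n : ℕ) : Submodule ℝ (Mat n) := selfAdjoint.submodule ℝ (Mat n)

open Classical in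
/-- The pullback of a function on `ℋ_{n,ℂ}` to the open cone of positive definite matrices in the
real vector space of Hermitian matrices (with the irrelevant value `0` outside of the cone). -/
def pullback {n : ℕ} (f : HermSpace n → ℝ) (A : HermMat n) : ℝ :=
  if h : (A : Mat n).PosDef then f (HermSpace.mk ⟨A, h⟩) else 0

/-- `q` is a critical point of `f : ℋ_{n,ℂ} → ℝ`, i.e. `f` is differentiable at `q` with `df(q) = 0`.
Since `ℋ_{n,ℂ}` is the quotient of the open cone of positive definite matrices by the free and proper
action of the positive reals by scaling, the projection from the cone is a surjective submersion, and
the condition says that the pullback of `f` to the cone has derivative `0` at the matrices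
representing `q`. -/
def IsCriticalPoint {n : ℕ} (f : HermSpace n → ℝ) (q : HermSpace n) : Prop :=
  ∀ Q : PosDefMat n, HermSpace.mk Q = q →
    HasFDerivAt (𝕜 := ℝ) (pullback f) 0 (⟨Q.1, Q.2.isHermitian⟩ : HermMat n)

/-! ### The distance function -/

/-- The value `P̄ Q Pᵀ` (a real number if `Q` is Hermitian). -/
def hermValue {n : ℕ} (Q : Mat n) (P : Vec n) : ℝ := (star P ⬝ᵥ (Q *ᵥ P)).re

theorem hermValue_pos {n : ℕ} (Q : PosDefMat n) (P : {v : Vec n // v ≠ 0}) :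
    0 < hermValue (Q : Mat n) (P : Vec n) :=
  Q.2.re_dotProduct_pos P.2

theorem hermValue_smul_vec {n : ℕ} (Q : Mat n) (c : ℂ) (P : Vec n) :
    hermValue Q (c • P) = Complex.normSq c * hermValue Q P := by
  unfold hermValue
  rw [Matrix.mulVec_smul, star_smul, smul_dotProduct, dotProduct_smul, smul_smul, smul_eq_mul,
    ← Complex.re_ofReal_mul, ← Complex.mul_conj, mul_comm c]
  rfl

theorem hermValue_smul_mat {n : ℕ} (Q : Mat n) (c : ℝ) (P : Vec n) :
    hermValue (c • Q) P = c * hermValue Q P := by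
  unfold hermValue
  rw [Matrix.smul_mulVec, dotProduct_smul, Complex.smul_re, smul_eq_mul]

/-- `∑ⱼ log (P̄ⱼ Q Pⱼᵀ) - m/(n+1) log det Q`, for coordinate vectors `Pⱼ` and a matrix `Q`. -/
def distCoords {n m : ℕ} (P : Coords n m) (Q : PosDefMat n) : ℝ :=
  ∑ j, Real.log (hermValue (Q : Mat n) (P j : Vec n))
    - (m : ℝ) / ((n : ℝ) + 1) * Real.log (Q : Mat n).det.re

theorem distCoords_eq {n m : ℕ} (P : Coords n m) (Q : PosDefMat n) (P' : Coords n m)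
    (Q' : PosDefMat n) (hP : P ≈ P') (hQ : Q ≈ Q') : distCoords P Q = distCoords P' Q' := by
  obtain ⟨σ, c, hc, hP⟩ := hP
  obtain ⟨d, hd, hQ⟩ := hQ
  have hne : ∀ j, Complex.normSq (c j) ≠ 0 := fun j hj => by
    have := Finset.prod_eq_zero (Finset.mem_univ j) (Complex.normSq_eq_zero.1 hj)
    rw [hc] at this
    exact one_ne_zero this
  have h1 : ∑ j, Real.log (Complex.normSq (c j)) = 0 := by
    rw [← Real.log_prod (fun j _ => hne j), ← map_prod, hc, map_one, Real.log_one]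
  have hdet : 0 < (Q : Mat n).det.re := (Complex.pos_iff.1 Q.2.det_pos).1
  have h2 : Real.log (Q' : Mat n).det.re
      = ((n : ℝ) + 1) * Real.log d + Real.log (Q : Mat n).det.re := by
    have : (Q' : Mat n).det = ((d ^ (n + 1) : ℝ) : ℂ) * (Q : Mat n).det := by
      rw [hQ, ← Complex.coe_smul, Matrix.det_smul]
      simp
    rw [this, Complex.re_ofReal_mul, Real.log_mul (pow_pos hd _).ne' hdet.ne', Real.log_pow]
    push_cast
    rfl
  have h3 : ∀ j, Real.log (hermValue (Q' : Mat n) (P' j : Vec n))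
      = Real.log (Complex.normSq (c j)) + Real.log d
        + Real.log (hermValue (Q : Mat n) (P (σ j) : Vec n)) := fun j => by
    have hp := hermValue_pos Q (P (σ j))
    rw [hQ, hP j, hermValue_smul_mat, hermValue_smul_vec,
      Real.log_mul hd.ne' (mul_ne_zero (hne j) hp.ne'), Real.log_mul (hne j) hp.ne']
    ring
  have h4 := Equiv.sum_comp σ (fun j => Real.log (hermValue (Q : Mat n) (P j : Vec n)))
  unfold distCoords
  simp only [h3, Finset.sum_add_distrib, h1, h2, h4, Finset.sum_const, Finset.card_univ,
    Fintype.card_fin, nsmul_eq_mul]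
  have : (n : ℝ) + 1 ≠ 0 := by positivity
  field_simp
  ring

/-- The distance function `D_{Z̃}(Q) = ∑ⱼ log (P̄ⱼ Q Pⱼᵀ) - m/(n+1) log det Q` on `ℋ_{n,ℂ}`. -/
def distFun {n m : ℕ} (Z : ScaledCluster n m) (q : HermSpace n) : ℝ :=
  Quotient.lift₂ distCoords distCoords_eq Z q

end PointClusters

end

open scoped LinearAlgebra.Projectivization Matrix ComplexOrder

noncomputable section

namespace PointClusters

/-! In coordinates `g` with the form written as `gᴴ diag(d) g`, the distance function is explicit in
`d`, and stability is only needed for the coordinate subspaces of `g`.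

Uniqueness: `exists_simultaneous_diagonal` turns two critical forms into `1` and `diag(d)`. The
vanishing derivatives in diagonal directions (`IsCriticalPoint.sum_normSq_div`), compared at the
indices where `d` is maximal, show that unless `d` is constant every point of the cluster lies in
one of two complementary coordinate subspaces. The two stability inequalities then add up to a
contradiction.

Existence: compactness of the unitary group makes stability quantitative
(`Cluster.IsStable.exists_uniform`), and summation by parts bounds the distance function below by a
constant plus `log (d_max / d_min) / (n + 1)` (`Cluster.IsStable.exists_le_spectralDist`).
Minimization thus reduces to a compact set. A minimizer is critical because the pullback is
differentiable on the open cone. Other coordinate vectors for the same cluster change the function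
by an additive constant (`Coords.exists_dist_eq_add`), so the minimizer depends on the cluster only.
-/

/-! ### Diagonal coordinates for positive definite forms -/

theorem hermValue_conj_diagonal {n : ℕ} (g : Mat n) (d : Fin (n + 1) → ℝ) (P : Vec n) :
    hermValue (gᴴ * Matrix.diagonal (fun i => (d i : ℂ)) * g) P
      = ∑ i, d i * Complex.normSq ((g *ᵥ P) i) := by
  unfold hermValue
  rw [Matrix.mul_assoc, ← Matrix.mulVec_mulVec, ← Matrix.mulVec_mulVec, Matrix.dotProduct_mulVec,
    ← Matrix.star_mulVec, dotProduct, Complex.re_sum]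
  refine Finset.sum_congr rfl fun i _ => ?_
  rw [Matrix.mulVec_diagonal, Pi.star_apply, mul_left_comm, Complex.re_ofReal_mul]
  congr 1
  rw [Complex.star_def, mul_comm, Complex.mul_conj, Complex.ofReal_re]

theorem det_conj_diagonal {n : ℕ} (g : Mat n) (d : Fin (n + 1) → ℝ) :
    (gᴴ * Matrix.diagonal (fun i => (d i : ℂ)) * g).det.re
      = Complex.normSq g.det * ∏ i, d i := by
  rw [Matrix.det_mul, Matrix.det_mul, Matrix.det_conjTranspose, Matrix.det_diagonal,
    mul_right_comm, Complex.star_def, mul_comm (starRingEnd ℂ _), Complex.mul_conj,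
    Complex.re_ofReal_mul, ← Complex.ofReal_prod, Complex.ofReal_re]

theorem posDef_conj_diagonal {n : ℕ} {g : Mat n} (hg : IsUnit g) {d : Fin (n + 1) → ℝ}
    (hd : ∀ i, 0 < d i) : (gᴴ * Matrix.diagonal (fun i => (d i : ℂ)) * g).PosDef := by
  rw [← Matrix.star_eq_conjTranspose, Matrix.IsUnit.posDef_star_left_conjugate_iff hg,
    Matrix.posDef_diagonal_iff]
  exact fun i => by exact_mod_cast hd i

/-- The positive definite matrix `gᴴ diag(d) g`. -/
def conjDiagonal {n : ℕ} {g : Mat n} (hg : IsUnit g) {d : Fin (n + 1) → ℝ}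
    (hd : ∀ i, 0 < d i) : PosDefMat n :=
  ⟨gᴴ * Matrix.diagonal (fun i => (d i : ℂ)) * g, posDef_conj_diagonal hg hd⟩

theorem normSq_det_pos {n : ℕ} {g : Mat n} (hg : IsUnit g) : 0 < Complex.normSq g.det :=
  Complex.normSq_pos.2 ((Matrix.isUnit_iff_isUnit_det g).1 hg).ne_zero

theorem distCoords_conjDiagonal {n m : ℕ} (P : Coords n m) {g : Mat n} (hg : IsUnit g)
    {d : Fin (n + 1) → ℝ} (hd : ∀ i, 0 < d i) :
    distCoords P (conjDiagonal hg hd)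
      = ∑ j, Real.log (∑ i, d i * Complex.normSq ((g *ᵥ (P j : Vec n)) i))
        - (m : ℝ) / ((n : ℝ) + 1)
          * (Real.log (Complex.normSq g.det) + ∑ i, Real.log (d i)) := by
  unfold distCoords conjDiagonal
  simp only [hermValue_conj_diagonal, det_conj_diagonal]
  rw [Real.log_mul (normSq_det_pos hg).ne' (Finset.prod_ne_zero_iff.2 fun i _ => (hd i).ne'),
    Real.log_prod fun i _ => (hd i).ne']

/-- Spectral theorem with the eigenvalues sorted: the ordering makes the relevant coordinate
subspaces initial segments in the summation by parts. -/
theorem exists_unitary_diagonal {n : ℕ} (Q : PosDefMat n) :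
    ∃ U ∈ Matrix.unitaryGroup (Fin (n + 1)) ℂ, ∃ d : Fin (n + 1) → ℝ, (∀ i, 0 < d i) ∧
      Monotone d ∧ (Q : Mat n) = Uᴴ * Matrix.diagonal (fun i => (d i : ℂ)) * U := by
  have hH := Q.2.isHermitian
  set V : Mat n := (hH.eigenvectorUnitary : Mat n) with hV
  set e := hH.eigenvalues
  set σ := Tuple.sort e
  have hspec : (Q : Mat n) = V * Matrix.diagonal (fun i => (e i : ℂ)) * Vᴴ := by
    conv_lhs => rw [hH.spectral_theorem]
    rfl
  have hVmem : V ∈ Matrix.unitaryGroup (Fin (n + 1)) ℂ := hH.eigenvectorUnitary.2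
  have h1 : Vᴴ * V = 1 := Matrix.mem_unitaryGroup_iff'.1 hVmem
  refine ⟨Vᴴ.submatrix σ id, ?_, e ∘ σ, fun i => Q.2.eigenvalues_pos _, Tuple.monotone_sort e, ?_⟩
  · rw [Matrix.mem_unitaryGroup_iff, Matrix.star_eq_conjTranspose, Matrix.conjTranspose_submatrix,
      Matrix.conjTranspose_conjTranspose]
    have : (Vᴴ.submatrix σ id) * (V.submatrix id σ) = (Vᴴ * V).submatrix σ σ := by
      rw [← Matrix.submatrix_mul _ _ _ id _ Function.bijective_id]
    rw [this, h1, Matrix.submatrix_one_equiv]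
  · have h2 : Matrix.diagonal (fun i => (((e ∘ σ) i : ℝ) : ℂ))
        = (Matrix.diagonal (fun i => (e i : ℂ))).submatrix σ σ := by
      rw [Matrix.submatrix_diagonal_equiv]; rfl
    rw [h2, Matrix.conjTranspose_submatrix, Matrix.conjTranspose_conjTranspose,
      ← Matrix.submatrix_mul _ _ _ _ _ σ.bijective, ← Matrix.submatrix_mul _ _ _ _ _ σ.bijective,
      Matrix.submatrix_id_id]
    exact hspec

theorem isUnit_of_mem_unitaryGroup {n : ℕ} {U : Mat n}
    (hU : U ∈ Matrix.unitaryGroup (Fin (n + 1)) ℂ) : IsUnit U :=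
  ⟨⟨U, star U, Matrix.mem_unitaryGroup_iff.1 hU, Matrix.mem_unitaryGroup_iff'.1 hU⟩, rfl⟩

theorem isUnit_diagonal {n : ℕ} {d : Fin (n + 1) → ℝ} (hd : ∀ i, 0 < d i) :
    IsUnit (Matrix.diagonal (fun i => (d i : ℂ)) : Mat n) := by
  rw [Matrix.isUnit_diagonal, Pi.isUnit_iff]
  exact fun i => isUnit_iff_ne_zero.2 (Complex.ofReal_ne_zero.2 (hd i).ne')

theorem exists_conjTranspose_mul_self {n : ℕ} (Q : PosDefMat n) :
    ∃ g : Mat n, IsUnit g ∧ (Q : Mat n) = gᴴ * g := by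
  obtain ⟨U, hU, d, hd, -, hQ⟩ := exists_unitary_diagonal Q
  refine ⟨Matrix.diagonal (fun i => ((√(d i) : ℝ) : ℂ)) * U,
    (isUnit_diagonal fun i => Real.sqrt_pos.2 (hd i)).mul (isUnit_of_mem_unitaryGroup hU), ?_⟩
  rw [Matrix.conjTranspose_mul, Matrix.diagonal_conjTranspose, hQ, Matrix.mul_assoc,
    Matrix.mul_assoc, ← Matrix.mul_assoc (Matrix.diagonal _) _ U, Matrix.diagonal_mul_diagonal]
  congr 3
  ext i
  rw [Pi.star_apply, Complex.star_def, Complex.conj_ofReal, ← Complex.ofReal_mul,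
    Real.mul_self_sqrt (hd i).le]

/-- Simultaneous diagonalization of two positive definite forms. -/
theorem exists_simultaneous_diagonal {n : ℕ} (Q Q' : PosDefMat n) :
    ∃ g : Mat n, IsUnit g ∧ ∃ d : Fin (n + 1) → ℝ, (∀ i, 0 < d i) ∧ (Q : Mat n) = gᴴ * g ∧
      (Q' : Mat n) = gᴴ * Matrix.diagonal (fun i => (d i : ℂ)) * g := by
  obtain ⟨B, hB, hQ⟩ := exists_conjTranspose_mul_self Q
  have hdet : IsUnit B.det := (Matrix.isUnit_iff_isUnit_det B).1 hB
  have hBB : B⁻¹ * B = 1 := Matrix.nonsing_inv_mul B hdet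
  have hpd : ((B⁻¹)ᴴ * (Q' : Mat n) * B⁻¹).PosDef := by
    rw [← Matrix.star_eq_conjTranspose, Matrix.IsUnit.posDef_star_left_conjugate_iff
      ((Matrix.isUnit_nonsing_inv_iff).2 hB)]
    exact Q'.2
  obtain ⟨U, hU, d, hd, -, hQ'⟩ := exists_unitary_diagonal ⟨_, hpd⟩
  have hBB' : Bᴴ * (B⁻¹)ᴴ = 1 := by
    rw [← Matrix.conjTranspose_mul, hBB, Matrix.conjTranspose_one]
  refine ⟨U * B, (isUnit_of_mem_unitaryGroup hU).mul hB, d, hd, ?_, ?_⟩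
  · have := Matrix.mem_unitaryGroup_iff'.1 hU
    rw [Matrix.star_eq_conjTranspose] at this
    rw [Matrix.conjTranspose_mul, Matrix.mul_assoc, ← Matrix.mul_assoc _ U B, this, Matrix.one_mul,
      hQ]
  · have h : (Q' : Mat n) = Bᴴ * ((B⁻¹)ᴴ * (Q' : Mat n) * B⁻¹) * B := by
      simp only [Matrix.mul_assoc, hBB, Matrix.mul_one]
      rw [← Matrix.mul_assoc, hBB', Matrix.one_mul]
    dsimp only at hQ'
    rw [h, hQ', Matrix.conjTranspose_mul]
    simp only [Matrix.mul_assoc]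

/-! ### Stability on coordinate subspaces -/

open Classical in
theorem Coords.degOn_toCluster {n m : ℕ} (P : Coords n m) (L : Submodule ℂ (Vec n)) :
    P.toCluster.degOn L = (Finset.univ.filter fun j => (P j : Vec n) ∈ L).card := by
  unfold Cluster.degOn Coords.toCluster
  rw [Sym.coe_mk, Multiset.countP_map, Finset.card_def, Finset.filter_val]
  congr 1
  refine Multiset.filter_congr fun j _ => ?_
  rw [Projectivization.submodule_mk, Submodule.span_singleton_le_iff_mem]

/-- The vectors `v` such that `g v` is supported in `S`. -/
def supportedIn {n : ℕ} (g : Mat n) (S : Finset (Fin (n + 1))) : Submodule ℂ (Vec n) where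
  carrier := {v | ∀ i ∉ S, (g *ᵥ v) i = 0}
  add_mem' ha hb i hi := by rw [Matrix.mulVec_add, Pi.add_apply, ha i hi, hb i hi, add_zero]
  zero_mem' i _ := by rw [Matrix.mulVec_zero]; rfl
  smul_mem' c v hv i hi := by rw [Matrix.mulVec_smul, Pi.smul_apply, hv i hi, smul_zero]

theorem mem_supportedIn {n : ℕ} {g : Mat n} {S : Finset (Fin (n + 1))} {v : Vec n} :
    v ∈ supportedIn g S ↔ ∀ i ∉ S, (g *ᵥ v) i = 0 := Iff.rfl

theorem finrank_supportedIn {n : ℕ} {g : Mat n} (hg : IsUnit g) (S : Finset (Fin (n + 1))) :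
    Module.finrank ℂ (supportedIn g S) = S.card := by
  have hdet : IsUnit g.det := (Matrix.isUnit_iff_isUnit_det g).1 hg
  let e : supportedIn g S ≃ₗ[ℂ] (S → ℂ) :=
    { toFun := fun v i => (g *ᵥ (v : Vec n)) i
      map_add' := fun v w => by ext i; simp [Matrix.mulVec_add]
      map_smul' := fun c v => by ext i; simp [Matrix.mulVec_smul]
      invFun := fun w => ⟨g⁻¹ *ᵥ fun i => if h : i ∈ S then w ⟨i, h⟩ else 0, fun i hi => by
        rw [Matrix.mulVec_mulVec, Matrix.mul_nonsing_inv g hdet, Matrix.one_mulVec, dif_neg hi]⟩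
      left_inv := fun v => by
        apply Subtype.ext
        have : (fun i => if h : i ∈ S then (g *ᵥ (v : Vec n)) i else 0) = g *ᵥ (v : Vec n) := by
          ext i
          split_ifs with h
          · rfl
          · exact (v.2 i h).symm
        simp only [dite_eq_ite] at this ⊢
        rw [this, Matrix.mulVec_mulVec, Matrix.nonsing_inv_mul g hdet, Matrix.one_mulVec]
      right_inv := fun w => by
        ext i
        simp [Matrix.mulVec_mulVec, Matrix.mul_nonsing_inv g hdet] }
  rw [e.finrank_eq, Module.finrank_fintype_fun_eq_card, Fintype.card_coe]

-- The stability hypothesis enters the argument only through this special case.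
open Classical in
theorem Cluster.IsStable.card_supported_lt {n m : ℕ} {P : Coords n m}
    (hP : P.toCluster.IsStable) {g : Mat n} (hg : IsUnit g) {S : Finset (Fin (n + 1))}
    (h0 : S.Nonempty) (h1 : S ≠ Finset.univ) :
    (n + 1) * (Finset.univ.filter fun j => ∀ i ∉ S, (g *ᵥ (P j : Vec n)) i = 0).card
      < S.card * m := by
  have hcard := finrank_supportedIn hg S
  have h := hP (supportedIn g S) (fun h => ?_) (fun h => ?_)
  · rw [Coords.degOn_toCluster, hcard] at h
    convert h
    exact mem_supportedIn.symm
  · rw [h, finrank_bot] at hcard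
    exact h0.card_pos.ne hcard
  · rw [h, finrank_top, Module.finrank_fintype_fun_eq_card] at hcard
    exact h1 ((Finset.card_eq_iff_eq_univ S).1 hcard.symm)

/-! ### Critical point equations and uniqueness -/

/-- The distance function of the cluster with coordinate vectors `P`. -/
abbrev Coords.dist {n m : ℕ} (P : Coords n m) : HermSpace n → ℝ :=
  distFun (Quotient.mk _ P : ScaledCluster n m)

theorem Coords.dist_mk {n m : ℕ} (P : Coords n m) (Q : PosDefMat n) :
    P.dist (HermSpace.mk Q) = distCoords P Q := rfl

section Derivative

attribute [local instance] Matrix.normedAddCommGroup Matrix.normedSpace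

theorem hasDerivAt_pullback_line {n : ℕ} {f : HermSpace n → ℝ} {A : HermMat n}
    (h : HasFDerivAt (𝕜 := ℝ) (pullback f) 0 A) (B : HermMat n) :
    HasDerivAt (fun t : ℝ => pullback f (A + t • B)) 0 0 := by
  have h1 : HasDerivAt (fun t : ℝ => A + t • B) B 0 := by
    have := ((hasDerivAt_id (0 : ℝ)).smul_const B).const_add A
    rwa [one_smul] at this
  have h2 : HasFDerivAt (𝕜 := ℝ) (pullback f) 0 (A + (0 : ℝ) • B) := by simpa using h
  exact h2.comp_hasDerivAt (0 : ℝ) h1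

end Derivative

theorem hermMat_conj_diagonal {n : ℕ} (g : Mat n) (d : Fin (n + 1) → ℝ) :
    gᴴ * Matrix.diagonal (fun i => (d i : ℂ)) * g ∈ HermMat n := by
  change (gᴴ * Matrix.diagonal (fun i => (d i : ℂ)) * g).IsHermitian
  refine Matrix.isHermitian_conjTranspose_mul_mul g ?_
  refine Matrix.isHermitian_diagonal_of_self_adjoint _ ?_
  ext i
  simp

theorem sum_mul_normSq_pos {n : ℕ} {g : Mat n} (hg : IsUnit g) {d : Fin (n + 1) → ℝ}
    (hd : ∀ i, 0 < d i) (v : {v : Vec n // v ≠ 0}) :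
    0 < ∑ i, d i * Complex.normSq ((g *ᵥ (v : Vec n)) i) := by
  rw [← hermValue_conj_diagonal]
  exact hermValue_pos (conjDiagonal hg hd) v

/-- At a critical point `gᴴ diag(d) g`, the derivatives in the diagonal directions vanish. -/
theorem IsCriticalPoint.sum_normSq_div {n m : ℕ} {P : Coords n m} {q : HermSpace n}
    (hq : IsCriticalPoint P.dist q) {g : Mat n} (hg : IsUnit g) {d : Fin (n + 1) → ℝ}
    (hd : ∀ i, 0 < d i) (h : HermSpace.mk (conjDiagonal hg hd) = q) (i : Fin (n + 1)) :
    ∑ j, Complex.normSq ((g *ᵥ (P j : Vec n)) i)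
        / ∑ k, d k * Complex.normSq ((g *ᵥ (P j : Vec n)) k)
      = (m : ℝ) / ((n : ℝ) + 1) / d i := by
  set w : Fin m → Fin (n + 1) → ℝ := fun j k => Complex.normSq ((g *ᵥ (P j : Vec n)) k) with hw
  -- Perturb only the `i`-th diagonal entry. For small `t` the entries `d k + t * e k` stay
  -- positive, so the explicit formula can be differentiated in place of the pullback.
  let e : Fin (n + 1) → ℝ := Pi.single i 1
  have h1 := hasDerivAt_pullback_line (hq _ h) ⟨_, hermMat_conj_diagonal g e⟩
  have hev : (fun t : ℝ => ∑ j, Real.log (∑ k, (d k + t * e k) * w j k)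
        - (m : ℝ) / ((n : ℝ) + 1)
          * (Real.log (Complex.normSq g.det) + ∑ k, Real.log (d k + t * e k)))
      =ᶠ[nhds 0] fun t : ℝ => pullback P.dist
        ((⟨(conjDiagonal hg hd).1, (conjDiagonal hg hd).2.isHermitian⟩ : HermMat n)
          + t • ⟨_, hermMat_conj_diagonal g e⟩) := by
    have hpos : ∀ᶠ t : ℝ in nhds 0, ∀ k, 0 < d k + t * e k := by
      rw [Filter.eventually_all]
      intro k
      have : Filter.Tendsto (fun t : ℝ => d k + t * e k) (nhds 0) (nhds (d k + 0 * e k)) :=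
        Continuous.tendsto (by fun_prop) 0
      refine this.eventually (lt_mem_nhds ?_)
      simpa using hd k
    filter_upwards [hpos] with t ht
    have hmat : (((⟨(conjDiagonal hg hd).1, (conjDiagonal hg hd).2.isHermitian⟩ : HermMat n)
          + t • ⟨_, hermMat_conj_diagonal g e⟩ : HermMat n) : Mat n) = conjDiagonal hg ht := by
      change gᴴ * Matrix.diagonal (fun k => (d k : ℂ)) * g
        + t • (gᴴ * Matrix.diagonal (fun k => (e k : ℂ)) * g)
        = gᴴ * Matrix.diagonal (fun k => ((d k + t * e k : ℝ) : ℂ)) * g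
      rw [← Matrix.smul_mul, ← Matrix.mul_smul, ← Matrix.add_mul, ← Matrix.mul_add,
        ← Matrix.diagonal_smul, Matrix.diagonal_add]
      congr 3
      ext k
      simp
    rw [← distCoords_conjDiagonal P hg ht, ← Coords.dist_mk]
    unfold pullback
    have hpd := (conjDiagonal hg ht).2
    rw [← hmat] at hpd
    rw [dif_pos hpd]
    congr 2
    exact Subtype.ext hmat.symm
  have h2 := h1.congr_of_eventuallyEq hev
  have hlin : ∀ k, HasDerivAt (fun t : ℝ => d k + t * e k) (e k) 0 := fun k => by
    simpa using ((hasDerivAt_id (0 : ℝ)).mul_const (e k)).const_add (d k)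
  have h3 : HasDerivAt (fun t : ℝ => ∑ j, Real.log (∑ k, (d k + t * e k) * w j k)
        - (m : ℝ) / ((n : ℝ) + 1)
          * (Real.log (Complex.normSq g.det) + ∑ k, Real.log (d k + t * e k)))
      (∑ j, (∑ k, e k * w j k) / (∑ k, d k * w j k)
        - (m : ℝ) / ((n : ℝ) + 1) * ∑ k, e k / d k) 0 := by
    refine HasDerivAt.sub (HasDerivAt.fun_sum fun j _ => ?_)
      (HasDerivAt.const_mul _ (HasDerivAt.const_add _ (HasDerivAt.fun_sum fun k _ => ?_)))
    · have := (HasDerivAt.fun_sum fun k (_ : k ∈ Finset.univ) =>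
        (hlin k).mul_const (w j k)).log (x := (0 : ℝ))
        (by simpa using (sum_mul_normSq_pos hg hd (P j)).ne')
      simpa using this
    · simpa using (hlin k).log (by simpa using (hd k).ne')
  have h4 := h3.unique h2
  have h5 : ∀ j, ∑ k, e k * w j k = w j i := fun j => by simp [e, Pi.single_apply]
  have h6 : ∑ k, e k / d k = 1 / d i := by simp [e, Pi.single_apply, ite_div]
  simp only [h5, h6] at h4
  rw [sub_eq_zero.1 h4]
  ring

/-- Critical points of the distance function of a stable cluster are unique. -/
theorem IsCriticalPoint.unique {n m : ℕ} {P : Coords n m} (hP : P.toCluster.IsStable)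
    {q q' : HermSpace n} (hq : IsCriticalPoint P.dist q) (hq' : IsCriticalPoint P.dist q') :
    q = q' := by
  classical
  obtain ⟨Q, rfl⟩ := Quotient.exists_rep q
  obtain ⟨Q', rfl⟩ := Quotient.exists_rep q'
  obtain ⟨g, hg, d, hd, hQ, hQ'⟩ := exists_simultaneous_diagonal Q Q'
  set w : Fin m → Fin (n + 1) → ℝ := fun j k => Complex.normSq ((g *ᵥ (P j : Vec n)) k) with hw
  have hw0 : ∀ j k, 0 ≤ w j k := fun j k => Complex.normSq_nonneg _
  have hone : ∀ i : Fin (n + 1), (0 : ℝ) < 1 := fun _ => one_pos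
  have e1 := hq.sum_normSq_div hg hone (congrArg HermSpace.mk (Subtype.ext (by
    simp [conjDiagonal, hQ])))
  have e2 := hq'.sum_normSq_div hg hd (congrArg HermSpace.mk (Subtype.ext (by
    simp [conjDiagonal, hQ'])))
  have p1 : ∀ j, 0 < ∑ k, w j k := fun j => by simpa using sum_mul_normSq_pos hg hone (P j)
  have p2 : ∀ j, 0 < ∑ k, d k * w j k := fun j => sum_mul_normSq_pos hg hd (P j)
  obtain ⟨i₀, hi₀⟩ := Finite.exists_max d
  by_cases hall : ∀ i, d i = d i₀
  · refine Quotient.sound ⟨d i₀, hd i₀, ?_⟩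
    rw [hQ', hQ]
    have : Matrix.diagonal (fun i => (d i : ℂ)) = (d i₀ : ℝ) • (1 : Mat n) := by
      rw [← Matrix.diagonal_one, ← Matrix.diagonal_smul]
      congr 1
      ext i
      simp [hall i]
    rw [this, Matrix.mul_smul, Matrix.smul_mul, Matrix.mul_one]
  exfalso
  -- The indices where `d` is maximal; nonempty and proper since `d` is not constant.
  set S : Finset (Fin (n + 1)) := Finset.univ.filter fun i => d i = d i₀ with hS
  have hS1 : S ≠ Finset.univ := fun h => hall fun i => by
    have : i ∈ S := h ▸ Finset.mem_univ i
    simpa [hS] using this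
  have hS0 : S.Nonempty := ⟨i₀, by simp [hS]⟩
  have hle : ∀ j, ∑ k, d k * w j k ≤ d i₀ * ∑ k, w j k := fun j => by
    rw [Finset.mul_sum]
    exact Finset.sum_le_sum fun k _ => mul_le_mul_of_nonneg_right (hi₀ k) (hw0 j k)
  -- For `i ∈ S` the difference of the two critical equations, the second multiplied by the maximum
  -- of `d`, is a vanishing sum of nonnegative terms. Each term vanishes, so `w j i ≠ 0` forces
  -- equality in `hle j`, that is, no weight outside `S`.
  have key : ∀ i ∈ S, ∀ j, w j i = 0 ∨ ∀ k ∉ S, w j k = 0 := by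
    intro i hi
    have hdi : d i = d i₀ := by simpa [hS] using hi
    have hsum : ∑ j, (d i₀ * w j i / (∑ k, d k * w j k) - w j i / ∑ k, w j k) = 0 := by
      rw [Finset.sum_sub_distrib]
      have a1 := e1 i
      have a2 := e2 i
      simp only [one_mul, div_one] at a1
      rw [a1]
      simp only [mul_div_assoc]
      rw [← Finset.mul_sum, a2, hdi]
      field_simp [(hd i₀).ne']
      ring
    have hnn : ∀ j ∈ Finset.univ,
        0 ≤ d i₀ * w j i / (∑ k, d k * w j k) - w j i / ∑ k, w j k := by
      intro j _
      rw [sub_nonneg, div_le_div_iff₀ (p1 j) (p2 j), mul_right_comm, mul_comm]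
      exact mul_le_mul_of_nonneg_right (hle j) (hw0 j i)
    intro j
    have hj := (Finset.sum_eq_zero_iff_of_nonneg hnn).1 hsum j (Finset.mem_univ j)
    rw [sub_eq_zero, div_eq_div_iff (p2 j).ne' (p1 j).ne'] at hj
    by_cases hz : w j i = 0
    · exact Or.inl hz
    right
    have hj' : d i₀ * ∑ k, w j k = ∑ k, d k * w j k := by
      apply mul_left_cancel₀ hz
      linarith
    rw [Finset.mul_sum, ← sub_eq_zero, ← Finset.sum_sub_distrib] at hj'
    intro k hk
    have hk' := (Finset.sum_eq_zero_iff_of_nonneg (fun k _ => sub_nonneg.2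
      (mul_le_mul_of_nonneg_right (hi₀ k) (hw0 j k)))).1 hj' k (Finset.mem_univ k)
    rw [← sub_mul] at hk'
    refine (mul_eq_zero.1 hk').resolve_left fun h0 => hk ?_
    simp only [hS, Finset.mem_filter, Finset.mem_univ, true_and]
    linarith
  have hc1 := hP.card_supported_lt hg hS0 hS1
  have hc2 := hP.card_supported_lt hg (S := Sᶜ)
    (Finset.nonempty_iff_ne_empty.2 fun h => hS1 (by simpa using h))
    (fun h => hS0.ne_empty (by simpa using h))
  -- By `key`, a point with a nonzero coordinate in `S` has none outside `S`, so the two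
  -- complementary subspaces together contain all `m` points.
  have hcov : m ≤ (Finset.univ.filter fun j => ∀ i ∉ S, (g *ᵥ (P j : Vec n)) i = 0).card
      + (Finset.univ.filter fun j => ∀ i ∉ Sᶜ, (g *ᵥ (P j : Vec n)) i = 0).card := by
    calc m = (Finset.univ : Finset (Fin m)).card := by simp
      _ ≤ _ := Finset.card_le_card fun j _ => ?_
      _ ≤ _ := Finset.card_union_le _ _
    simp only [Finset.mem_union, Finset.mem_filter, Finset.mem_univ, true_and,
      Finset.mem_compl, not_not]
    by_contra! hcon
    obtain ⟨⟨k, hk, hk0⟩, i, hi, hi0⟩ := hcon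
    rcases key i hi j with h | h
    · exact hi0 (Complex.normSq_eq_zero.1 h)
    · exact hk0 (Complex.normSq_eq_zero.1 (h k hk))
  have hcardS : S.card + Sᶜ.card = n + 1 := by rw [Finset.card_add_card_compl, Fintype.card_fin]
  have : (n + 1) * m < (n + 1) * m := by
    calc (n + 1) * m ≤ (n + 1) * _ := Nat.mul_le_mul_left _ hcov
      _ = _ := Nat.mul_add _ _ _
      _ < S.card * m + Sᶜ.card * m := Nat.add_lt_add hc1 hc2
      _ = (n + 1) * m := by rw [← Nat.add_mul, hcardS]
  exact lt_irrefl _ this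

/-! ### Openness of the cone, and minimizers as critical points -/

theorem continuous_hermValue {n : ℕ} :
    Continuous fun x : HermMat n × Vec n => hermValue (x.1 : Mat n) x.2 := by
  unfold hermValue
  exact Complex.continuous_re.comp (Continuous.dotProduct (by fun_prop)
    (Continuous.matrix_mulVec (by fun_prop) (by fun_prop)))

theorem posDef_of_hermValue_pos {n : ℕ} (A : HermMat n)
    (h : ∀ x ∈ Metric.sphere (0 : Vec n) 1, 0 < hermValue (A : Mat n) x) :
    (A : Mat n).PosDef := by
  have hA : (A : Mat n).IsHermitian := A.2
  refine Matrix.PosDef.of_dotProduct_mulVec_pos hA fun x hx => ?_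
  have hx' : ‖x‖ ≠ 0 := norm_ne_zero_iff.2 hx
  rw [Complex.pos_iff]
  refine ⟨?_, (hA.im_star_dotProduct_mulVec_self x).symm⟩
  change 0 < hermValue (A : Mat n) x
  have hu := h (((‖x‖⁻¹ : ℝ) : ℂ) • x) (by
    rw [mem_sphere_zero_iff_norm, norm_smul, Complex.norm_real, norm_inv, norm_norm,
      inv_mul_cancel₀ hx'])
  rw [hermValue_smul_vec] at hu
  exact pos_of_mul_pos_right hu (Complex.normSq_nonneg _)

/-- Positivity only has to be tested on the unit sphere, whose compactness makes the open condition
uniform in the vector. -/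
theorem eventually_posDef {n : ℕ} (A : HermMat n) (hA : (A : Mat n).PosDef) :
    ∀ᶠ B : HermMat n in nhds A, (B : Mat n).PosDef := by
  have h : ∀ᶠ B : HermMat n in nhds A, ∀ x ∈ Metric.sphere (0 : Vec n) 1,
      0 < hermValue (B : Mat n) x := by
    refine (isCompact_sphere (0 : Vec n) 1).eventually_forall_of_forall_eventually fun x hx => ?_
    refine continuous_hermValue.continuousAt.eventually (lt_mem_nhds ?_)
    exact hermValue_pos ⟨_, hA⟩ ⟨x, fun h0 => by simp [h0] at hx⟩
  exact h.mono posDef_of_hermValue_pos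

section Derivative

attribute [local instance] Matrix.normedAddCommGroup Matrix.normedSpace

theorem differentiable_hermMat_apply {n : ℕ} (i k : Fin (n + 1)) :
    Differentiable ℝ fun A : HermMat n => (A : Mat n) i k := by
  have h1 : Differentiable ℝ fun A : HermMat n => (A : Mat n) :=
    (HermMat n).subtypeL.differentiable
  exact fun A => differentiableAt_pi.1 (differentiableAt_pi.1 (h1 A) i) k

theorem differentiable_hermValue {n : ℕ} (v : Vec n) :
    Differentiable ℝ fun A : HermMat n => hermValue (A : Mat n) v := by
  have := @differentiable_hermMat_apply n
  unfold hermValue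
  refine Complex.reCLM.differentiable.comp ?_
  simp only [dotProduct, Matrix.mulVec]
  refine Differentiable.fun_sum fun i _ => Differentiable.const_mul ?_ _
  exact Differentiable.fun_sum fun k _ => (this i k).mul_const _

theorem differentiable_det_re {n : ℕ} :
    Differentiable ℝ fun A : HermMat n => (A : Mat n).det.re := by
  have := @differentiable_hermMat_apply n
  refine Complex.reCLM.differentiable.comp ?_
  simp only [Matrix.det_apply]
  refine Differentiable.fun_sum fun σ _ => Differentiable.fun_const_smul ?_ _
  exact fun A => (HasFDerivAt.finsetProd fun i _ => (this (σ i) i A).hasFDerivAt).differentiableAt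

theorem hasFDerivAt_zero_of_isLocalMin {n : ℕ} {f : HermMat n → ℝ} {A : HermMat n}
    (h : IsLocalMin f A) (hf : DifferentiableAt ℝ f A) : HasFDerivAt (𝕜 := ℝ) f 0 A := by
  have := hf.hasFDerivAt
  have h0 := h.hasFDerivAt_eq_zero this
  rwa [h0] at this

theorem isCriticalPoint_of_forall_le {n m : ℕ} (P : Coords n m) {q : HermSpace n}
    (h : ∀ q', P.dist q ≤ P.dist q') : IsCriticalPoint P.dist q := by
  rintro Q rfl
  have hev := eventually_posDef (⟨Q.1, Q.2.isHermitian⟩ : HermMat n) Q.2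
  have hQ : pullback P.dist (⟨Q.1, Q.2.isHermitian⟩ : HermMat n) = P.dist (HermSpace.mk Q) :=
    dif_pos Q.2
  refine hasFDerivAt_zero_of_isLocalMin ?_ ?_
  · filter_upwards [hev] with B hB
    rw [hQ]
    unfold pullback
    rw [dif_pos hB]
    exact h _
  · have hd : DifferentiableAt ℝ (fun A : HermMat n =>
        ∑ j, Real.log (hermValue (A : Mat n) (P j : Vec n))
          - (m : ℝ) / ((n : ℝ) + 1) * Real.log (A : Mat n).det.re)
        (⟨Q.1, Q.2.isHermitian⟩ : HermMat n) := by
      refine (DifferentiableAt.fun_sum fun j _ => ?_).sub (DifferentiableAt.const_mul ?_ _)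
      · exact (differentiable_hermValue _).differentiableAt.log (hermValue_pos Q (P j)).ne'
      · exact differentiable_det_re.differentiableAt.log (Complex.pos_iff.1 Q.2.det_pos).1.ne'
    refine hd.congr_of_eventuallyEq ?_
    filter_upwards [hev] with B hB
    exact dif_pos hB

end Derivative

/-! ### Uniform stability over the unitary group -/

theorem isCompact_unitaryGroup (n : ℕ) :
    IsCompact (Matrix.unitaryGroup (Fin (n + 1)) ℂ : Set (Mat n)) := by
  have hK : IsCompact (Set.univ.pi fun _ => Set.univ.pi fun _ =>
      Metric.closedBall (0 : ℂ) 1 : Set (Fin (n + 1) → Fin (n + 1) → ℂ)) :=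
    isCompact_univ_pi fun _ => isCompact_univ_pi fun _ => isCompact_closedBall 0 1
  refine IsCompact.of_isClosed_subset (X := Mat n) hK ?_ fun U hU i _ k _ => ?_
  · have : (Matrix.unitaryGroup (Fin (n + 1)) ℂ : Set (Mat n)) = {U | U * Uᴴ = 1} := by
      ext U
      exact Matrix.mem_unitaryGroup_iff
    rw [this]
    exact isClosed_eq (Continuous.matrix_mul continuous_id continuous_id.matrix_conjTranspose)
      continuous_const
  · rw [mem_closedBall_zero_iff]
    exact entry_norm_bound_of_unitary hU i k

theorem continuous_normSq_mulVec {n : ℕ} (v : Vec n) (i : Fin (n + 1)) :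
    Continuous fun U : Mat n => Complex.normSq ((U *ᵥ v) i) :=
  Complex.continuous_normSq.comp
    ((continuous_apply i).comp (Continuous.matrix_mulVec continuous_id continuous_const))

theorem mulVec_ne_zero_of_isUnit {n : ℕ} {g : Mat n} (hg : IsUnit g) {v : Vec n} (hv : v ≠ 0) :
    g *ᵥ v ≠ 0 := fun h =>
  hv (Matrix.mulVec_injective_of_isUnit hg (h.trans (Matrix.mulVec_zero g).symm))

/-- A quantitative form of stability, uniform over all unitary coordinate changes. -/
theorem Cluster.IsStable.exists_uniform {n m : ℕ} {P : Coords n m} (hP : P.toCluster.IsStable) :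
    ∃ δ : ℝ, 0 < δ ∧ ∀ U ∈ Matrix.unitaryGroup (Fin (n + 1)) ℂ, ∀ S : Finset (Fin (n + 1)),
      S ≠ Finset.univ → ∀ J : Finset (Fin m), J.Nonempty →
        (∀ j ∈ J, ∀ i ∉ S, Complex.normSq ((U *ᵥ (P j : Vec n)) i) < δ) →
        (n + 1) * J.card < S.card * m := by
  classical
  have h1 : ∀ x : Finset (Fin (n + 1)) × Finset (Fin m), ∃ ε : ℝ, 0 < ε ∧
      ∀ U ∈ Matrix.unitaryGroup (Fin (n + 1)) ℂ, x.1 ≠ Finset.univ → x.2.Nonempty →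
        x.1.card * m ≤ (n + 1) * x.2.card →
        ε ≤ ∑ j ∈ x.2, ∑ i ∈ x.1ᶜ, Complex.normSq ((U *ᵥ (P j : Vec n)) i) := by
    rintro ⟨S, J⟩
    by_cases h : S ≠ Finset.univ ∧ J.Nonempty ∧ S.card * m ≤ (n + 1) * J.card
    · obtain ⟨hS, hJ, hc⟩ := h
      -- If the minimum were zero, the points in `J` would lie exactly in the coordinate subspace of
      -- `S` for `U₀`, against stability, or, when `S` is empty, would have zero coordinate vectors.
      obtain ⟨U₀, hU₀, hmin⟩ := (isCompact_unitaryGroup n).exists_isMinOn ⟨1, one_mem _⟩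
        (f := fun U => ∑ j ∈ J, ∑ i ∈ Sᶜ, Complex.normSq ((U *ᵥ (P j : Vec n)) i))
        (continuous_finsetSum _ fun j _ => continuous_finsetSum _ fun i _ =>
          continuous_normSq_mulVec _ i).continuousOn
      refine ⟨_, ?_, fun U hU _ _ _ => hmin hU⟩
      have hnn : ∀ j ∈ J, 0 ≤ ∑ i ∈ Sᶜ, Complex.normSq ((U₀ *ᵥ (P j : Vec n)) i) :=
        fun j _ => Finset.sum_nonneg fun i _ => Complex.normSq_nonneg _
      refine (Finset.sum_nonneg hnn).lt_of_ne fun h0 => ?_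
      have hz : ∀ j ∈ J, ∀ i ∉ S, (U₀ *ᵥ (P j : Vec n)) i = 0 := fun j hj i hi => by
        have h2 := (Finset.sum_eq_zero_iff_of_nonneg hnn).1 h0.symm j hj
        exact Complex.normSq_eq_zero.1 ((Finset.sum_eq_zero_iff_of_nonneg
          fun i _ => Complex.normSq_nonneg _).1 h2 i (Finset.mem_compl.2 hi))
      have hg := isUnit_of_mem_unitaryGroup hU₀
      rcases S.eq_empty_or_nonempty with rfl | hS0
      · obtain ⟨j, hj⟩ := hJ
        exact mulVec_ne_zero_of_isUnit hg (P j).2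
          (funext fun i => hz j hj i (Finset.notMem_empty i))
      · refine absurd (hP.card_supported_lt hg hS0 hS) (not_lt.2 (hc.trans ?_))
        refine Nat.mul_le_mul_left _ (Finset.card_le_card fun j hj => ?_)
        exact Finset.mem_filter.2 ⟨Finset.mem_univ j, hz j hj⟩
    · exact ⟨1, one_pos, fun U _ a b c => absurd ⟨a, b, c⟩ h⟩
  choose ε hε hε' using h1
  obtain ⟨x₀, hx₀⟩ := Finite.exists_min ε
  -- At most `m * (n + 1)` terms below this bound have a sum smaller than `ε x₀`; the extra `1`
  -- gives strictness and a nonzero denominator.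
  refine ⟨ε x₀ / (m * (n + 1) + 1), div_pos (hε x₀) (by positivity), ?_⟩
  intro U hU S hS J hJ hlt
  by_contra! hc
  have h2 := (hx₀ (S, J)).trans (hε' (S, J) U hU hS hJ hc)
  set δ := ε x₀ / (m * (n + 1) + 1) with hδ
  have hδ0 : 0 < δ := div_pos (hε x₀) (by positivity)
  have h3 : ∑ j ∈ J, ∑ i ∈ Sᶜ, Complex.normSq ((U *ᵥ (P j : Vec n)) i)
      ≤ (m * (n + 1)) * δ := by
    calc _ ≤ ∑ j ∈ J, ∑ i ∈ Sᶜ, δ := Finset.sum_le_sum fun j hj => Finset.sum_le_sum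
          fun i hi => (hlt j hj i (Finset.mem_compl.1 hi)).le
      _ = (J.card * Sᶜ.card : ℝ) * δ := by
          simp only [Finset.sum_const, nsmul_eq_mul, mul_assoc]
      _ ≤ _ := by
          gcongr
          · exact (Finset.card_le_univ J).trans_eq (Fintype.card_fin m)
          · exact_mod_cast (Finset.card_le_univ Sᶜ).trans_eq (Fintype.card_fin (n + 1))
  have h4 : ε x₀ = (m * (n + 1) + 1) * δ := by
    rw [hδ, mul_div_cancel₀]
    positivity
  dsimp only at h2
  linarith

/-! ### Summation by parts and the growth bound -/

theorem eq_last_sub_sum_increments {n : ℕ} (x : Fin (n + 1) → ℝ) (i : Fin (n + 1)) :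
    x i = x (Fin.last n)
      - ∑ k : Fin n, if i ≤ k.castSucc then x k.succ - x k.castSucc else 0 := by
  induction i using Fin.reverseInduction with
  | last =>
    rw [Finset.sum_eq_zero, sub_zero]
    intro k _
    rw [if_neg (not_le.2 k.castSucc_lt_last)]
  | cast i ih =>
    have h : ∀ k : Fin n, (if i.castSucc ≤ k.castSucc then x k.succ - x k.castSucc else 0)
        = (if i = k then x k.succ - x k.castSucc else 0)
          + if i.succ ≤ k.castSucc then x k.succ - x k.castSucc else 0 := fun k => by
      simp only [Fin.castSucc_le_castSucc_iff, Fin.succ_le_castSucc_iff]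
      rcases lt_trichotomy i k with h | h | h
      · simp [h, h.le, h.ne]
      · simp [h]
      · simp [h.not_ge, h.ne', h.not_gt]
    simp only [h, Finset.sum_add_distrib, Finset.sum_ite_eq, Finset.mem_univ, if_true]
    linarith

theorem sum_comp_eq_sub_sum_increments {ι : Type*} [Fintype ι] {n : ℕ} (x : Fin (n + 1) → ℝ)
    (a : ι → Fin (n + 1)) :
    ∑ j, x (a j) = Fintype.card ι * x (Fin.last n)
      - ∑ k : Fin n, ((Finset.univ.filter fun j => a j ≤ k.castSucc).card : ℝ)
          * (x k.succ - x k.castSucc) := by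
  have h : ∀ j, x (a j) = _ := fun j => eq_last_sub_sum_increments x (a j)
  rw [Finset.sum_congr rfl fun j _ => h j, Finset.sum_sub_distrib, Finset.sum_const,
    Finset.card_univ, nsmul_eq_mul, Finset.sum_comm]
  congr 1
  refine Finset.sum_congr rfl fun k _ => ?_
  rw [← Finset.sum_filter, Finset.sum_const, nsmul_eq_mul]

/-- Abel summation writes both sums through the increments of `x`, which are nonnegative. Each
strict inequality between integers has a gap of at least `1`, so every increment contributes at
least `1 / (n + 1)` of itself. -/
theorem range_div_le_sum_sub {n m : ℕ} {x : Fin (n + 1) → ℝ} (hx : Monotone x)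
    (a : Fin m → Fin (n + 1))
    (h : ∀ k : Fin n, (n + 1) * (Finset.univ.filter fun j => a j ≤ k.castSucc).card
      < (k + 1) * m) :
    (x (Fin.last n) - x 0) / (n + 1) ≤ ∑ j, x (a j) - m / (n + 1) * ∑ i, x i := by
  have h1 := sum_comp_eq_sub_sum_increments x a
  have h2 := sum_comp_eq_sub_sum_increments x id
  have h3 := eq_last_sub_sum_increments x 0
  have hcard : ∀ k : Fin n,
      (Finset.univ.filter fun j : Fin (n + 1) => j ≤ k.castSucc).card = k + 1 := fun k => by
    have : (Finset.univ.filter fun j : Fin (n + 1) => j ≤ k.castSucc)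
        = Finset.Iic k.castSucc := by
      ext j
      simp
    rw [this, Fin.card_Iic, Fin.val_castSucc]
  simp only [id, hcard, Fintype.card_fin] at h1 h2
  simp only [Fin.zero_le, if_true] at h3
  have hn : (0 : ℝ) < n + 1 := by positivity
  rw [div_le_iff₀ hn, sub_mul, mul_right_comm, div_mul_cancel₀ _ hn.ne', h1, h2]
  have h4 : ∀ k : Fin n, (x k.succ - x k.castSucc)
      ≤ m * (((k : ℕ) + 1 : ℕ) * (x k.succ - x k.castSucc))
        - (n + 1) * (((Finset.univ.filter fun j => a j ≤ k.castSucc).card : ℝ)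
          * (x k.succ - x k.castSucc)) := fun k => by
    have hk : ((n + 1 : ℝ)) * (Finset.univ.filter fun j => a j ≤ k.castSucc).card + 1
        ≤ ((k : ℕ) + 1 : ℕ) * m := by
      exact_mod_cast h k
    have := mul_le_mul_of_nonneg_right hk (sub_nonneg.2 (hx k.castSucc_lt_succ.le))
    linarith
  have h5 : ∑ k : Fin n, (x k.succ - x k.castSucc)
      ≤ m * ∑ k : Fin n, (((k : ℕ) + 1 : ℕ) * (x k.succ - x k.castSucc))
        - (n + 1) * ∑ k : Fin n, (((Finset.univ.filter fun j => a j ≤ k.castSucc).card : ℝ)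
          * (x k.succ - x k.castSucc)) := by
    rw [Finset.mul_sum, Finset.mul_sum, ← Finset.sum_sub_distrib]
    exact Finset.sum_le_sum fun k _ => h4 k
  push_cast at h5 ⊢
  linarith

/-- The distance function in the coordinates given by a unitary matrix `U` and the eigenvalues
`d`. -/
def spectralDist {n m : ℕ} (P : Coords n m) (U : Mat n) (d : Fin (n + 1) → ℝ) : ℝ :=
  ∑ j, Real.log (∑ i, d i * Complex.normSq ((U *ᵥ (P j : Vec n)) i))
    - (m : ℝ) / ((n : ℝ) + 1) * ∑ i, Real.log (d i)

theorem distCoords_eq_spectralDist {n m : ℕ} (P : Coords n m) {U : Mat n}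
    (hU : U ∈ Matrix.unitaryGroup (Fin (n + 1)) ℂ) {d : Fin (n + 1) → ℝ} (hd : ∀ i, 0 < d i) :
    distCoords P (conjDiagonal (isUnit_of_mem_unitaryGroup hU) hd) = spectralDist P U d := by
  have h : Complex.normSq U.det = 1 := by
    have := Matrix.det_of_mem_unitary hU
    rw [Unitary.mem_iff_self_mul_star, Complex.star_def, Complex.mul_conj] at this
    exact_mod_cast this
  rw [distCoords_conjDiagonal, h, Real.log_one, zero_add]
  rfl

/-- Properness modulo scaling: the distance function grows at least linearly in the logarithmic
spread of the eigenvalues, uniformly in the eigenbasis. -/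
theorem Cluster.IsStable.exists_le_spectralDist {n m : ℕ} {P : Coords n m}
    (hP : P.toCluster.IsStable) :
    ∃ C : ℝ, ∀ U ∈ Matrix.unitaryGroup (Fin (n + 1)) ℂ, ∀ d : Fin (n + 1) → ℝ, (∀ i, 0 < d i) →
      Monotone d →
      C + (Real.log (d (Fin.last n)) - Real.log (d 0)) / (n + 1) ≤ spectralDist P U d := by
  obtain ⟨δ, hδ, h⟩ := hP.exists_uniform
  refine ⟨m * Real.log δ, fun U hU d hd hmono => ?_⟩
  -- The last coordinate of the `j`-th point that is not small. It exists by uniform stability with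
  -- `S = ∅`, whose conclusion is absurd.
  have hex : ∀ j, ∃ i, δ ≤ Complex.normSq ((U *ᵥ (P j : Vec n)) i) ∧
      ∀ k, δ ≤ Complex.normSq ((U *ᵥ (P j : Vec n)) k) → k ≤ i := fun j => by
    have hne : (Finset.univ.filter fun i =>
        δ ≤ Complex.normSq ((U *ᵥ (P j : Vec n)) i)).Nonempty := by
      by_contra hcon
      rw [Finset.not_nonempty_iff_eq_empty, Finset.filter_eq_empty_iff] at hcon
      have := h U hU ∅ Finset.univ_nonempty.ne_empty.symm {j} (Finset.singleton_nonempty j)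
        fun j' hj' i _ => by
          rw [Finset.mem_singleton.1 hj']
          exact not_le.1 (hcon (Finset.mem_univ i))
      simp at this
    obtain ⟨i, hi, hi'⟩ := Finset.exists_max_image _ id hne
    refine ⟨i, (Finset.mem_filter.1 hi).2, fun k hk => hi' k ?_⟩
    exact Finset.mem_filter.2 ⟨Finset.mem_univ k, hk⟩
  choose a ha ha' using hex
  have hx : Monotone fun i => Real.log (d i) := fun i k hik => Real.log_le_log (hd i) (hmono hik)
  have hcount : ∀ k : Fin n, (n + 1) * (Finset.univ.filter fun j => a j ≤ k.castSucc).card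
      < (k + 1) * m := fun k => by
    have hS : (Finset.Iic k.castSucc).card = k + 1 := by simp
    have hS1 : Finset.Iic k.castSucc ≠ Finset.univ := fun h => by
      have := Finset.mem_univ (Fin.last n)
      rw [← h, Finset.mem_Iic] at this
      exact absurd this (not_le.2 k.castSucc_lt_last)
    rcases (Finset.univ.filter fun j => a j ≤ k.castSucc).eq_empty_or_nonempty with h0 | h0
    -- Uniform stability needs a nonempty `J`; here only `0 < m` is missing, and stability for the
    -- standard basis supplies it.
    · have := hP.card_supported_lt isUnit_one ⟨k.castSucc, Finset.mem_Iic.2 le_rfl⟩ hS1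
      rw [hS] at this
      rw [h0, Finset.card_empty, mul_zero]
      exact pos_of_gt this
    · have := h U hU (Finset.Iic k.castSucc) hS1 _ h0 fun j hj i hi => by
        by_contra! hcon
        exact hi (Finset.mem_Iic.2 ((ha' j i hcon).trans (Finset.mem_filter.1 hj).2))
      rwa [hS] at this
  have h1 := range_div_le_sum_sub hx a hcount
  have h2 : ∀ j, Real.log δ + Real.log (d (a j))
      ≤ Real.log (∑ i, d i * Complex.normSq ((U *ᵥ (P j : Vec n)) i)) := fun j => by
    rw [add_comm, ← Real.log_mul (hd _).ne' hδ.ne']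
    refine Real.log_le_log (mul_pos (hd _) hδ)
      ((mul_le_mul_of_nonneg_left (ha j) (hd _).le).trans ?_)
    exact Finset.single_le_sum (f := fun i => d i * Complex.normSq ((U *ᵥ (P j : Vec n)) i))
      (fun i _ => mul_nonneg (hd i).le (Complex.normSq_nonneg _)) (Finset.mem_univ (a j))
  have h3 := Finset.sum_le_sum fun j (_ : j ∈ Finset.univ) => h2 j
  rw [Finset.sum_add_distrib, Finset.sum_const, Finset.card_univ, Fintype.card_fin,
    nsmul_eq_mul] at h3
  unfold spectralDist
  linarith

/-! ### Existence of the minimum -/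

theorem continuousOn_spectralDist {n m : ℕ} (P : Coords n m) :
    ContinuousOn (fun x : Mat n × (Fin (n + 1) → ℝ) => spectralDist P x.1 x.2)
      ((Matrix.unitaryGroup (Fin (n + 1)) ℂ : Set (Mat n)) ×ˢ {d | ∀ i, 0 < d i}) := by
  unfold spectralDist
  refine ContinuousOn.sub (continuousOn_finsetSum _ fun j _ => ContinuousOn.log ?_ ?_)
    (ContinuousOn.mul continuousOn_const (continuousOn_finsetSum _ fun i _ =>
      ContinuousOn.log ?_ ?_))
  · refine (continuous_finsetSum _ fun i _ => Continuous.mul (by fun_prop) ?_).continuousOn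
    exact (continuous_normSq_mulVec _ i).comp continuous_fst
  · exact fun x hx => (sum_mul_normSq_pos (isUnit_of_mem_unitaryGroup hx.1) hx.2 (P j)).ne'
  · fun_prop
  · exact fun x hx => (hx.2 i).ne'

/-- The distance function of a stable cluster attains its minimum. -/
theorem Cluster.IsStable.exists_forall_dist_le {n m : ℕ} {P : Coords n m}
    (hP : P.toCluster.IsStable) : ∃ q, ∀ q', P.dist q ≤ P.dist q' := by
  obtain ⟨C, hC⟩ := hP.exists_le_spectralDist
  have hn : (0 : ℝ) < n + 1 := by positivity
  have hI := hC 1 (one_mem _) (fun _ => 1) (fun _ => one_pos) monotone_const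
  simp only [sub_self, zero_div, add_zero] at hI
  set D := spectralDist P 1 fun _ => 1 with hD
  -- With the smallest eigenvalue scaled to `1`, the growth bound confines every form of value at
  -- most `D` to eigenvalues in `[1, b]`. Forms of value at least `D` cannot beat the identity,
  -- which lies in `K`.
  set b : ℝ := Real.exp ((n + 1) * (D - C)) with hb
  have hb1 : 1 ≤ b := Real.one_le_exp (mul_nonneg hn.le (sub_nonneg.2 hI))
  set K : Set (Mat n × (Fin (n + 1) → ℝ)) :=
    (Matrix.unitaryGroup (Fin (n + 1)) ℂ : Set (Mat n)) ×ˢ Set.univ.pi fun _ => Set.Icc 1 b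
    with hK
  have hKc : IsCompact K :=
    (isCompact_unitaryGroup n).prod (isCompact_univ_pi fun _ => isCompact_Icc)
  have hpos : ∀ x ∈ K, ∀ i, 0 < x.2 i := fun x hx i =>
    one_pos.trans_le (hx.2 i (Set.mem_univ i)).1
  have h1K : ((1 : Mat n), fun _ => (1 : ℝ)) ∈ K :=
    ⟨one_mem (Matrix.unitaryGroup (Fin (n + 1)) ℂ), fun _ _ => ⟨le_rfl, hb1⟩⟩
  obtain ⟨x₀, hx₀, hmin⟩ := hKc.exists_isMinOn ⟨_, h1K⟩
    ((continuousOn_spectralDist P).mono fun x hx => ⟨hx.1, hpos x hx⟩)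
  refine ⟨HermSpace.mk (conjDiagonal (isUnit_of_mem_unitaryGroup hx₀.1) (hpos x₀ hx₀)), fun q' => ?_⟩
  obtain ⟨Q, rfl⟩ := Quotient.exists_rep q'
  obtain ⟨U, hU, d, hd, hmono, hQ⟩ := exists_unitary_diagonal Q
  have hd' : ∀ i, 0 < (d 0)⁻¹ * d i := fun i => mul_pos (inv_pos.2 (hd 0)) (hd i)
  have hmono' : Monotone fun i => (d 0)⁻¹ * d i := hmono.const_mul (inv_pos.2 (hd 0)).le
  have heq : HermSpace.mk Q
      = HermSpace.mk (conjDiagonal (isUnit_of_mem_unitaryGroup hU) hd') := by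
    refine Quotient.sound ⟨(d 0)⁻¹, inv_pos.2 (hd 0), ?_⟩
    rw [hQ, ← Matrix.smul_mul, ← Matrix.mul_smul, ← Matrix.diagonal_smul]
    change Uᴴ * Matrix.diagonal _ * U = _
    congr 3
    ext i
    simp
  change _ ≤ P.dist (HermSpace.mk Q)
  rw [heq, Coords.dist_mk, Coords.dist_mk, distCoords_eq_spectralDist P hx₀.1,
    distCoords_eq_spectralDist P hU]
  rcases le_total D (spectralDist P U fun i => (d 0)⁻¹ * d i) with h | h
  · exact (hmin h1K).trans h
  · have h2 := (hC U hU _ hd' hmono').trans h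
    rw [inv_mul_cancel₀ (hd 0).ne', Real.log_one, sub_zero, ← le_sub_iff_add_le',
      div_le_iff₀ hn, mul_comm _ ((n : ℝ) + 1), Real.log_le_iff_le_exp (hd' _)] at h2
    refine hmin (a := (U, fun i => (d 0)⁻¹ * d i)) ⟨hU, fun i _ => ⟨?_, ?_⟩⟩
    · simpa [(hd 0).ne'] using hmono' (Fin.zero_le i)
    · exact (hmono' (Fin.le_last i)).trans h2

/-! ### Independence of the scaling -/

/-- The distance function in terms of the underlying cluster, up to an additive constant. -/
theorem Coords.exists_distCoords_add_eq {n m : ℕ} (P : Coords n m) : ∃ c : ℝ, ∀ Q : PosDefMat n,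
    distCoords P Q + c
      = ((P.toCluster : Multiset (ℙ ℂ (Vec n))).map fun p =>
          Real.log (hermValue (Q : Mat n) p.rep)).sum
        - (m : ℝ) / ((n : ℝ) + 1) * Real.log (Q : Mat n).det.re := by
  choose a ha using fun j => Projectivization.exists_smul_eq_mk_rep ℂ (P j : Vec n) (P j).2
  refine ⟨∑ j, Real.log (Complex.normSq (a j)), fun Q => ?_⟩
  have h : ((P.toCluster : Multiset (ℙ ℂ (Vec n))).map fun p =>
      Real.log (hermValue (Q : Mat n) p.rep)).sum
      = ∑ j, Real.log (hermValue (Q : Mat n)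
          (Projectivization.mk ℂ (P j : Vec n) (P j).2).rep) := by
    unfold Coords.toCluster
    rw [Sym.coe_mk, Multiset.map_map]
    rfl
  have h' : ∀ j, Real.log (hermValue (Q : Mat n)
      (Projectivization.mk ℂ (P j : Vec n) (P j).2).rep)
      = Real.log (Complex.normSq (a j)) + Real.log (hermValue (Q : Mat n) (P j : Vec n)) :=
    fun j => by
      rw [← ha j, Units.smul_def, hermValue_smul_vec, Real.log_mul
        (Complex.normSq_pos.2 (a j).ne_zero).ne' (hermValue_pos Q (P j)).ne']
  rw [h]
  simp only [h', Finset.sum_add_distrib]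
  unfold distCoords
  ring

theorem Coords.exists_dist_eq_add {n m : ℕ} {P P' : Coords n m}
    (h : P.toCluster = P'.toCluster) : ∃ c : ℝ, ∀ q, P'.dist q = P.dist q + c := by
  obtain ⟨c, hc⟩ := P.exists_distCoords_add_eq
  obtain ⟨c', hc'⟩ := P'.exists_distCoords_add_eq
  refine ⟨c - c', fun q => ?_⟩
  obtain ⟨Q, rfl⟩ := Quotient.exists_rep q
  change distCoords P' Q = distCoords P Q + (c - c')
  have h1 := hc Q
  have h2 := hc' Q
  rw [h] at h1
  linarith

theorem StableCluster.exists_minimizer {n m : ℕ} (Z : StableCluster n m) :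
    ∃ q : HermSpace n, ∀ P : Coords n m, P.toCluster = Z.1 → ∀ q', P.dist q ≤ P.dist q' := by
  by_cases h : ∃ P : Coords n m, P.toCluster = Z.1
  · obtain ⟨P, hP⟩ := h
    have hs := Z.2
    rw [← hP] at hs
    obtain ⟨q, hq⟩ := hs.exists_forall_dist_le
    refine ⟨q, fun P' hP' q' => ?_⟩
    obtain ⟨c, hc⟩ := Coords.exists_dist_eq_add (hP.trans hP'.symm)
    rw [hc, hc]
    exact add_le_add_left (hq q') c
  -- Without coordinates for `Z` the claim is vacuous, so any point of the space serves.
  · exact ⟨HermSpace.mk ⟨1, Matrix.PosDef.one⟩, fun P hP => absurd ⟨P, hP⟩ h⟩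

end PointClusters

end

theorem mainTheorem1 (n m : ℕ) :
    ∃ (z : PointClusters.StableCluster n m → PointClusters.HermSpace n)
      (θ : PointClusters.StableScaledCluster n m → ℝ),
      ∀ Z : PointClusters.StableScaledCluster n m,
        (∀ q : PointClusters.HermSpace n,
          PointClusters.IsCriticalPoint (PointClusters.distFun Z.1) q ↔ q = z Z.toStable) ∧
        0 < θ Z ∧
        PointClusters.distFun Z.1 (z Z.toStable) = Real.log (θ Z) ∧
        ∀ q : PointClusters.HermSpace n, Real.log (θ Z) ≤ PointClusters.distFun Z.1 q := by
  choose z hz using @PointClusters.StableCluster.exists_minimizer n m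
  refine ⟨z, fun Z => Real.exp (PointClusters.distFun Z.1 (z Z.toStable)), fun Z => ?_⟩
  have hmin : ∀ q, PointClusters.distFun Z.1 (z Z.toStable) ≤ PointClusters.distFun Z.1 q := by
    obtain ⟨⟨P⟩, hP⟩ := Z
    exact hz _ P rfl
  refine ⟨fun q => ?_, Real.exp_pos _, (Real.log_exp _).symm, fun q => by
    rw [Real.log_exp]
    exact hmin q⟩
  -- Only minimality of the point matters from here on; forgetting its origin allows passing to
  -- representatives of `Z`.
  generalize z Z.toStable = q₀ at hmin
  obtain ⟨⟨P⟩, hP⟩ := Z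
  have hcrit := PointClusters.isCriticalPoint_of_forall_le P hmin
  exact ⟨fun hq => PointClusters.IsCriticalPoint.unique hP hq hcrit, fun h => h ▸ hcrit⟩
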